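/- **Theorem 3.2.** Let $F_d\in\mathbb R^{d\times d_m}$ with $d\ge 1$ (parameter-to-observable map of all $d$ candidate sensors), let $\Gamma_{\rm pr}\in\mathbb R^{d_m\times d_m}$ be symmetric positive definite (prior covariance of the parameter $m$), let $P\in\mathbb R^{d_\rho\times d_m}$ be such that $\Sigma_{\rm pr}:=P\Gamma_{\rm pr}P^T$ is invertible (prior covariance of the quantity of interest $\rho=Pm$), and let $\Gamma_{\rm n}^d=\mathrm{diag}(\sigma_1^2,\dots,\sigma_d^2)$ with all $\sigma_i>0$ and $\sigma_{\min}^2:=\min_i\sigma_i^2$. A design is a matrix $W\in\{0,1\}^{r\times d}$ all of whose row sums equal $1$ and all of whose column sums lie in $\{0,1\}$. Put $$H_d:=F_d\Gamma_{\rm pr}F_d^T,\qquad H_d^\rho:=F_d\Gamma_{\rm pr}P^T\Sigma_{\rm pr}^{-1}P\Gamma_{\rm pr}F_d^T,\qquad \Delta H_d:=H_d-H_d^\rho,$$ $$P_\dagger:=\Gamma_{\rm pr}P^T\Sigma_{\rm pr}^{-1},\qquad \Gamma_\eta(W):=W\Gamma_{\rm n}^dW^T+WF_d\bigl(\Gamma_{\rm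 pr}-\Gamma_{\rm pr}P^T\Sigma_{\rm pr}^{-1}P\Gamma_{\rm pr}\bigr)F_d^TW^T,$$ and let the goal-oriented expected information gain (EIG) of $W$ be $$\Psi^\rho(W):=\tfrac12\log\det\Bigl(I+\Sigma_{\rm pr}^{1/2}(WF_dP_\dagger)^T\,\Gamma_\eta(W)^{-1}\,(WF_dP_\dagger)\,\Sigma_{\rm pr}^{1/2}\Bigr).$$ Let $H_d^\rho=U\,\mathrm{diag}(\zeta_1,\dots,\zeta_d)\,U^T$ and $\Delta H_d=V\,\mathrm{diag}(\lambda_1,\dots,\lambda_d)\,V^T$ be eigendecompositions with $U,V$ orthogonal, $\zeta_1\ge\dots\ge\zeta_d$ and $\lambda_1\ge\dots\ge\lambda_d$. For $0\le k,l\le d$ let $U_k$, $V_l$ consist of the first $k$ columns of $U$ and the first $l$ columns of $V$, and set $$\hat H_d^\rho:=U_k\,\mathrm{diag}(\zeta_1,\dots,\zeta_k)\,U_k^T,\qquad \Delta\hat H_d:=V_l\,\mathrm{diag}(\lambda_1,\dots,\lambda_l)\,V_l^T,\qquad \hat\Gamma_\eta(W):=W(\Gamma_{\rm n}^d+\Delta\hat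 H_d)W^T .$$ With a factorization $\hat\Gamma_\eta(W)^{-1}=\hat L\hat L^T$, $\hat L\in\mathbb R^{r\times r}$ (for instance the Cholesky factorization), let the approximate EIG be $$\hat\Psi^\rho(W):=\tfrac12\log\det\bigl(I_r+\hat L^TW\hat H_d^\rho W^T\hat L\bigr).$$ Then for every design $W$ $$\bigl|\Psi^\rho(W)-\hat\Psi^\rho(W)\bigr|\le\frac12\sum_{i=k+1}^{d}\log\Bigl(1+\frac{\zeta_i}{\sigma_{\min}^2}\Bigr)+\frac12\sum_{i=l+1}^{\min(l+k,\,d)}\log\Bigl(1+\frac{\lambda_i\,\zeta_1}{\sigma_{\min}^4}\Bigr).$$ -/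

import Mathlib

namespace GOOED

open Matrix

/-- Boolean design matrices `W ∈ ℝ^{r × d}`: the `i`-th sensor is placed at the `j`-th candidate
location iff `W i j = 1`; every sensor is placed once, every location is used at most once. -/
structure IsDesign {r d : ℕ} (W : Matrix (Fin r) (Fin d) ℝ) : Prop where
  entry : ∀ i j, W i j = 0 ∨ W i j = 1
  row_sum : ∀ i, ∑ j, W i j = 1
  col_sum : ∀ j, (∑ i, W i j = 0) ∨ (∑ i, W i j = 1)

section Model

variable {d dm dρ r : ℕ}

/-- Noise covariance `Γ_n^d = diag(σ₁², …, σ_d²)` of all candidate sensors. -/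
def noiseCov (σ : Fin d → ℝ) : Matrix (Fin d) (Fin d) ℝ :=
  diagonal fun i => σ i ^ 2

/-- `σ²_min = min(σ₁², …, σ_d²)`. -/
noncomputable def sigmaMinSq [NeZero d] (σ : Fin d → ℝ) : ℝ :=
  Finset.univ.inf' Finset.univ_nonempty fun i => σ i ^ 2

/-- Prior covariance `Σ_pr = P Γ_pr P*` of the quantity of interest `ρ = P m`. -/
def qoiPriorCov (Γpr : Matrix (Fin dm) (Fin dm) ℝ) (P : Matrix (Fin dρ) (Fin dm) ℝ) :
    Matrix (Fin dρ) (Fin dρ) ℝ :=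
  P * Γpr * Pᵀ

/-- `P_† = Γ_pr P* Σ_pr⁻¹`. -/
noncomputable def Pdagger (Γpr : Matrix (Fin dm) (Fin dm) ℝ) (P : Matrix (Fin dρ) (Fin dm) ℝ) :
    Matrix (Fin dm) (Fin dρ) ℝ :=
  Γpr * Pᵀ * (qoiPriorCov Γpr P)⁻¹

/-- Effective noise covariance
`Γ_η(W) = Γ_n(W) + F(W) (Γ_pr - Γ_pr P* Σ_pr⁻¹ P Γ_pr) F(W)*`,
with `F(W) = W F_d` and `Γ_n(W) = W Γ_n^d Wᵀ`. -/
noncomputable def etaCov (Fd : Matrix (Fin d) (Fin dm) ℝ) (Γpr : Matrix (Fin dm) (Fin dm) ℝ)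
    (P : Matrix (Fin dρ) (Fin dm) ℝ) (σ : Fin d → ℝ) (W : Matrix (Fin r) (Fin d) ℝ) :
    Matrix (Fin r) (Fin r) ℝ :=
  W * noiseCov σ * Wᵀ
    + W * Fd * (Γpr - Γpr * Pᵀ * (qoiPriorCov Γpr P)⁻¹ * P * Γpr) * (W * Fd)ᵀ

/-- Goal-oriented data-misfit Hessian `H_m^ρ(W) = (F(W) P_†)* Γ_η(W)⁻¹ F(W) P_†`. -/
noncomputable def goalHessian (Fd : Matrix (Fin d) (Fin dm) ℝ)
    (Γpr : Matrix (Fin dm) (Fin dm) ℝ) (P : Matrix (Fin dρ) (Fin dm) ℝ) (σ : Fin d → ℝ)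
    (W : Matrix (Fin r) (Fin d) ℝ) : Matrix (Fin dρ) (Fin dρ) ℝ :=
  (W * Fd * Pdagger Γpr P)ᵀ * (etaCov Fd Γpr P σ W)⁻¹ * (W * Fd * Pdagger Γpr P)

open scoped MatrixOrder Matrix.Norms.L2Operator in
/-- Goal-oriented expected information gain
`Ψ^ρ(W) = ½ log det (I + Σ_pr^{1/2} H_m^ρ(W) Σ_pr^{1/2})`. -/
noncomputable def eig (Fd : Matrix (Fin d) (Fin dm) ℝ)
    (Γpr : Matrix (Fin dm) (Fin dm) ℝ) (P : Matrix (Fin dρ) (Fin dm) ℝ) (σ : Fin d → ℝ)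
    (W : Matrix (Fin r) (Fin d) ℝ) : ℝ :=
  1 / 2 * Real.log (1 + CFC.sqrt (qoiPriorCov Γpr P) * goalHessian Fd Γpr P σ W
    * CFC.sqrt (qoiPriorCov Γpr P)).det

/-- `H_d = F_d Γ_pr F_d*`. -/
def Hd (Fd : Matrix (Fin d) (Fin dm) ℝ) (Γpr : Matrix (Fin dm) (Fin dm) ℝ) :
    Matrix (Fin d) (Fin d) ℝ :=
  Fd * Γpr * Fdᵀ

/-- `H_d^ρ = F_d Γ_pr P* Σ_pr⁻¹ P Γ_pr F_d*`. -/
noncomputable def Hdρ (Fd : Matrix (Fin d) (Fin dm) ℝ) (Γpr : Matrix (Fin dm) (Fin dm) ℝ)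
    (P : Matrix (Fin dρ) (Fin dm) ℝ) : Matrix (Fin d) (Fin d) ℝ :=
  Fd * Γpr * Pᵀ * (qoiPriorCov Γpr P)⁻¹ * P * Γpr * Fdᵀ

/-- `ΔH_d = H_d - H_d^ρ`. -/
noncomputable def ΔHd (Fd : Matrix (Fin d) (Fin dm) ℝ) (Γpr : Matrix (Fin dm) (Fin dm) ℝ)
    (P : Matrix (Fin dρ) (Fin dm) ℝ) : Matrix (Fin d) (Fin d) ℝ :=
  Hd Fd Γpr - Hdρ Fd Γpr P

end Model

section LowRank

variable {d r : ℕ}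

/-- `H = U diag(ζ) Uᵀ` is an eigendecomposition of `H`: the columns of `U` are an orthonormal
basis of eigenvectors, and the eigenvalues `ζ` are in non-increasing order. -/
structure IsEigendecomposition (H U : Matrix (Fin d) (Fin d) ℝ) (ζ : Fin d → ℝ) : Prop where
  orthogonal : Uᵀ * U = 1
  antitone : Antitone ζ
  eq : H = U * diagonal ζ * Uᵀ

/-- Truncated eigendecomposition `U_k Z_k U_kᵀ`, where `U_k` consists of the first `k` columns of
`U` and `Z_k = diag(ζ₁, …, ζ_k)`. -/
def truncation (U : Matrix (Fin d) (Fin d) ℝ) (ζ : Fin d → ℝ) {k : ℕ} (hk : k ≤ d) :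
    Matrix (Fin d) (Fin d) ℝ :=
  U.submatrix id (Fin.castLE hk) * diagonal (fun i : Fin k => ζ (Fin.castLE hk i))
    * (U.submatrix id (Fin.castLE hk))ᵀ

/-- `Γ̂_η(W) = W (Γ_n^d + ΔĤ_d) Wᵀ`. -/
def etaCovApprox (σ : Fin d → ℝ) (ΔHhat : Matrix (Fin d) (Fin d) ℝ)
    (W : Matrix (Fin r) (Fin d) ℝ) : Matrix (Fin r) (Fin r) ℝ :=
  W * (noiseCov σ + ΔHhat) * Wᵀ

/-- Approximate expected information gain `Ψ̂^ρ(W) = ½ log det (I_r + L̂ᵀ W Ĥ_d^ρ Wᵀ L̂)`. -/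
noncomputable def eigApprox (Hhat : Matrix (Fin d) (Fin d) ℝ) (Lhat : Matrix (Fin r) (Fin r) ℝ)
    (W : Matrix (Fin r) (Fin d) ℝ) : ℝ :=
  1 / 2 * Real.log (1 + Lhatᵀ * W * Hhat * Wᵀ * Lhat).det

end LowRank

end GOOED

/-! Let `B` and `C` be the exact and truncated effective noise covariances, `A = W * Hdρ * Wᵀ`, and
let `X * Xᵀ` be its truncated version, where `X` has `k` columns. By Sylvester's identity the gains
are ½ log det (1 + B⁻¹A) and ½ log det (1 + C⁻¹XXᵀ). The discarded eigenvalues are nonnegative, so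
XXᵀ ≤ A and C ≤ B, and both determinants dominate p = det (1 + XᵀB⁻¹X). It remains to bound each of
them above in terms of p (`abs_log_det_sub_log_det_le`).

From XXᵀ to A: the relative increase of a determinant is antitone in its base
(`det_add_mul_det_le`), so the base may be lowered to s = σ²_min, which leaves the factors 1 + ζᵢ/s.

From B to C: C⁻¹ - B⁻¹ ≤ C⁻¹(B - C)C⁻¹, so the cost is at most det (1 + Mᵀ diag(μ) M) with MᵀM ≤
ζ₁/s². As `M` has only `k` columns, only the `k` largest discarded λᵢ enter
(`det_one_add_conj_diagonal_le`). -/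

namespace GOOED

open Matrix
open scoped MatrixOrder

/-! ### Loewner order, inverses and determinants. -/

section General

variable {m n : Type*} [Fintype m] [Fintype n]

/-- Conjugation `A ↦ M A Mᵀ` is monotone in the Loewner order. -/
theorem conj_le_conj {A B : Matrix n n ℝ} (h : A ≤ B) (M : Matrix m n ℝ) :
    M * A * Mᵀ ≤ M * B * Mᵀ := by
  have := (Matrix.le_iff.mp h).mul_mul_conjTranspose_same M
  rwa [conjTranspose_eq_transpose_of_trivial, Matrix.mul_sub, Matrix.sub_mul,
    ← Matrix.le_iff] at this

/-- The congruence `A ↦ Mᵀ A M` is monotone in the Loewner order. -/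
theorem conj_le_conj' {A B : Matrix n n ℝ} (h : A ≤ B) (M : Matrix n m ℝ) :
    Mᵀ * A * M ≤ Mᵀ * B * M := by
  simpa using conj_le_conj h Mᵀ

theorem conj_nonneg {A : Matrix n n ℝ} (h : 0 ≤ A) (M : Matrix m n ℝ) : 0 ≤ M * A * Mᵀ := by
  simpa using conj_le_conj h M

theorem conj_nonneg' {A : Matrix n n ℝ} (h : 0 ≤ A) (M : Matrix n m ℝ) : 0 ≤ Mᵀ * A * M := by
  simpa using conj_le_conj' h M

theorem mul_transpose_nonneg (M : Matrix m n ℝ) : 0 ≤ M * Mᵀ := by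
  simpa using nonneg_iff_posSemidef.mpr (posSemidef_self_mul_conjTranspose M)

theorem smul_le_smul_left_of_nonneg {ι : Type*} {A B : Matrix ι ι ℝ} (h : A ≤ B) {c : ℝ}
    (hc : 0 ≤ c) :
    c • A ≤ c • B := by
  rw [Matrix.le_iff, ← smul_sub]
  exact (Matrix.le_iff.mp h).smul hc

theorem posDef_of_le {ι : Type*} {A B : Matrix ι ι ℝ} (hA : A.PosDef) (h : A ≤ B) : B.PosDef := by
  simpa using hA.add_posSemidef (Matrix.le_iff.mp h)

variable [DecidableEq m] [DecidableEq n]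

theorem exists_eq_mul_transpose {A : Matrix n n ℝ} (h : 0 ≤ A) :
    ∃ Y : Matrix n n ℝ, A = Y * Yᵀ := by
  obtain ⟨Y, hY⟩ := CStarAlgebra.nonneg_iff_eq_star_mul_self.mp h
  refine ⟨Yᵀ, ?_⟩
  rw [hY, star_eq_conjTranspose, conjTranspose_eq_transpose_of_trivial, transpose_transpose]

theorem diagonal_le_diagonal {ι : Type*} [DecidableEq ι] {a b : ι → ℝ} (h : a ≤ b) :
    diagonal a ≤ diagonal b := by
  rw [Matrix.le_iff, diagonal_sub]
  exact PosSemidef.diagonal fun i => sub_nonneg.mpr (h i)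

theorem posDef_one_add {ι : Type*} [DecidableEq ι] {A : Matrix ι ι ℝ} (h : 0 ≤ A) : (1 + A).PosDef :=
  PosDef.one.add_posSemidef (nonneg_iff_posSemidef.mp h)

theorem isUnit_det_of_posDef {A : Matrix n n ℝ} (hA : A.PosDef) : IsUnit A.det :=
  hA.det_pos.ne'.isUnit

theorem one_le_det_one_add {A : Matrix n n ℝ} (h : 0 ≤ A) : 1 ≤ (1 + A).det := by
  have hA := nonneg_iff_posSemidef.mp h
  have hs := hA.1.spectral_theorem
  set U := hA.1.eigenvectorUnitary
  rw [Unitary.conjStarAlgAut_apply] at hs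
  rw [hs, Matrix.mul_assoc, det_one_add_mul_comm, Matrix.mul_assoc]
  have hU : star (U : Matrix n n ℝ) * (U : Matrix n n ℝ) = 1 := by simp
  rw [hU, Matrix.mul_one, ← diagonal_one, diagonal_add, det_diagonal]
  have hp : ∀ i ∈ Finset.univ, 1 ≤ 1 + hA.1.eigenvalues i := fun i _ => by
    linarith [hA.eigenvalues_nonneg i]
  simpa using Finset.prod_le_prod (fun _ _ => zero_le_one) hp

/-- The determinant is monotone on positive definite matrices. -/
theorem det_le_det {A B : Matrix n n ℝ} (hA : A.PosDef) (h : A ≤ B) : A.det ≤ B.det := by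
  obtain ⟨Y, hY⟩ := exists_eq_mul_transpose (sub_nonneg.mpr h)
  have hB : B = A + Y * Yᵀ := by rw [← hY, add_sub_cancel]
  rw [hB, det_add_mul _ _ (isUnit_det_of_posDef hA)]
  have hnn := nonneg_iff_posSemidef.mpr hA.inv.posSemidef
  exact le_mul_of_one_le_right hA.det_pos.le (one_le_det_one_add (conj_nonneg' hnn Y))

theorem det_one_add_le {A B : Matrix n n ℝ} (hA : 0 ≤ A) (h : A ≤ B) :
    (1 + A).det ≤ (1 + B).det :=
  det_le_det (posDef_one_add hA) (add_le_add_right h 1)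

/-- Inversion is antitone on positive definite matrices. -/
theorem inv_le_inv_of_le {A B : Matrix n n ℝ} (hA : A.PosDef) (h : A ≤ B) : B⁻¹ ≤ A⁻¹ := by
  have hB := posDef_of_le hA h
  let _ := hA.inv.isUnit.invertible
  let _ := hB.isUnit.invertible
  -- The block matrix [[A⁻¹, 1], [1, B]] has the two Schur complements B - A and A⁻¹ - B⁻¹, so they
  -- are positive semidefinite together.
  have h1 := PosDef.fromBlocks₁₁ (1 : Matrix n n ℝ) B hA.inv
  have h2 := PosDef.fromBlocks₂₂ A⁻¹ (1 : Matrix n n ℝ) hB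
  rw [nonsing_inv_nonsing_inv _ (isUnit_det_of_posDef hA)] at h1
  simp only [conjTranspose_one, Matrix.one_mul, Matrix.mul_one] at h1 h2
  exact h2.mp (h1.mpr h)

theorem inv_nonneg_of_posDef {A : Matrix n n ℝ} (hA : A.PosDef) : 0 ≤ A⁻¹ :=
  nonneg_iff_posSemidef.mpr hA.inv.posSemidef

/-- If `Mᵀ M ≤ c` then `M Mᵀ ≤ c`. -/
theorem mul_transpose_le_of_transpose_mul_le {M : Matrix m n ℝ} {c : ℝ} (hc : 0 ≤ c)
    (h : Mᵀ * M ≤ c • 1) : M * Mᵀ ≤ c • 1 := by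
  rw [Matrix.le_iff]
  refine .of_dotProduct_mulVec_nonneg ?_ fun x => ?_
  · simp [IsHermitian, conjTranspose_eq_transpose_of_trivial]
  · have h1 := (Matrix.le_iff.mp h).dotProduct_mulVec_nonneg (Mᵀ *ᵥ x)
    set y := Mᵀ *ᵥ x with hy
    have e1 : star x ⬝ᵥ (c • (1 : Matrix m m ℝ) - M * Mᵀ) *ᵥ x = c * (x ⬝ᵥ x) - y ⬝ᵥ y := by
      simp [sub_mulVec, smul_mulVec, ← mulVec_mulVec, dotProduct_mulVec x M, ← mulVec_transpose,
        ← hy]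
    have e2 : star y ⬝ᵥ (c • (1 : Matrix n n ℝ) - Mᵀ * M) *ᵥ y
        = c * (y ⬝ᵥ y) - (M *ᵥ y) ⬝ᵥ (M *ᵥ y) := by
      simp [sub_mulVec, smul_mulVec, ← mulVec_mulVec, dotProduct_mulVec y Mᵀ, ← mulVec_transpose]
    have e3 : y ⬝ᵥ y = x ⬝ᵥ (M *ᵥ y) := by
      rw [dotProduct_mulVec x M, ← mulVec_transpose, ← hy]
    rw [e1]
    rw [e2] at h1
    -- Cauchy–Schwarz with y = Mᵀx: |y|⁴ ≤ |x|² |My|² ≤ c |x|² |y|²; then |y|² is cancelled.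
    have hcs : (x ⬝ᵥ (M *ᵥ y)) ^ 2 ≤ (x ⬝ᵥ x) * ((M *ᵥ y) ⬝ᵥ (M *ᵥ y)) := by
      simpa [dotProduct, sq] using Finset.sum_mul_sq_le_sq_mul_sq Finset.univ x (M *ᵥ y)
    have hx : 0 ≤ x ⬝ᵥ x := by simpa using dotProduct_star_self_nonneg x
    have hy0 : 0 ≤ y ⬝ᵥ y := by simpa using dotProduct_star_self_nonneg y
    rw [← e3] at hcs
    have hmul : (y ⬝ᵥ y) * (y ⬝ᵥ y) ≤ (c * (x ⬝ᵥ x)) * (y ⬝ᵥ y) := by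
      linarith [mul_le_mul_of_nonneg_left (sub_nonneg.mp h1) hx]
    rcases hy0.eq_or_lt with h0 | hpos
    · rw [← h0, sub_zero]
      exact mul_nonneg hc hx
    · exact sub_nonneg.mpr (le_of_mul_le_mul_right hmul hpos)

theorem inv_le_inv_smul_one {A : Matrix n n ℝ} {s : ℝ} (hs : 0 < s) (h : s • 1 ≤ A) :
    A⁻¹ ≤ s⁻¹ • 1 := by
  have := inv_le_inv_of_le (PosDef.one.smul hs) h
  rwa [inv_eq_left_inv (A := s • (1 : Matrix n n ℝ)) (B := s⁻¹ • 1)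
    (by simp [smul_smul, hs.ne'])] at this

/-- Squaring is not Loewner monotone in general. For a scalar bound it works: with A⁻¹ = YYᵀ, the
square is Y(YᵀY)Yᵀ, and YᵀY obeys the same scalar bound as YYᵀ. -/
theorem inv_mul_inv_le {A : Matrix n n ℝ} {s : ℝ} (hs : 0 < s) (h : s • 1 ≤ A) :
    A⁻¹ * A⁻¹ ≤ (s ^ 2)⁻¹ • 1 := by
  have hA := inv_le_inv_smul_one hs h
  have hs' := (inv_pos.mpr hs).le
  obtain ⟨Y, hY⟩ := exists_eq_mul_transpose
    (inv_nonneg_of_posDef (posDef_of_le (PosDef.one.smul hs) h))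
  have hYY : Yᵀ * Y ≤ s⁻¹ • 1 := by
    simpa using mul_transpose_le_of_transpose_mul_le (M := Yᵀ) hs' (by simpa [← hY] using hA)
  calc A⁻¹ * A⁻¹ = Y * (Yᵀ * Y) * Yᵀ := by rw [hY]; simp only [Matrix.mul_assoc]
    _ ≤ Y * (s⁻¹ • 1) * Yᵀ := conj_le_conj hYY Y
    _ = s⁻¹ • A⁻¹ := by rw [hY]; simp
    _ ≤ s⁻¹ • s⁻¹ • 1 := smul_le_smul_left_of_nonneg hA hs'
    _ = (s ^ 2)⁻¹ • 1 := by rw [smul_smul]; congr 1; field_simp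

/-! ### Determinant estimates for the two truncation errors. -/

/-- The relative increase `det (A + G) / det A` of the determinant is antitone in `A`. -/
theorem det_add_mul_det_le {A B G : Matrix n n ℝ} (hA : A.PosDef) (h : A ≤ B) (hG : 0 ≤ G) :
    (B + G).det * A.det ≤ B.det * (A + G).det := by
  have hB := posDef_of_le hA h
  obtain ⟨Y, rfl⟩ := exists_eq_mul_transpose hG
  rw [det_add_mul _ _ (isUnit_det_of_posDef hA), det_add_mul _ _ (isUnit_det_of_posDef hB)]
  have := det_one_add_le (conj_nonneg' (inv_nonneg_of_posDef hB) Y)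
    (conj_le_conj' (inv_le_inv_of_le hA h) Y)
  nlinarith [mul_le_mul_of_nonneg_left this (mul_pos hB.det_pos hA.det_pos).le]

/-- By the resolvent identity used twice, the gap between the two sides is A⁻¹D(A + D)⁻¹DA⁻¹ ≥ 0. -/
theorem inv_sub_inv_add_le {A D : Matrix n n ℝ} (hA : A.PosDef) (hD : 0 ≤ D) :
    A⁻¹ - (A + D)⁻¹ ≤ A⁻¹ * D * A⁻¹ := by
  have hB : (A + D).PosDef := hA.add_posSemidef (nonneg_iff_posSemidef.mp hD)
  have hAu := isUnit_det_of_posDef hA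
  have hBu := isUnit_det_of_posDef hB
  have hAT : A⁻¹ᵀ = A⁻¹ := by simpa [IsHermitian] using hA.inv.isHermitian
  have hDT : Dᵀ = D := by simpa [IsHermitian] using (nonneg_iff_posSemidef.mp hD).isHermitian
  have h1 : A⁻¹ - (A + D)⁻¹ = A⁻¹ * D * (A + D)⁻¹ := by
    calc A⁻¹ - (A + D)⁻¹ = A⁻¹ * ((A + D) * (A + D)⁻¹) - A⁻¹ * A * (A + D)⁻¹ := by
          rw [mul_nonsing_inv _ hBu, nonsing_inv_mul _ hAu, Matrix.mul_one, Matrix.one_mul]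
      _ = _ := by noncomm_ring
  have h2 : A⁻¹ - (A + D)⁻¹ = (A + D)⁻¹ * D * A⁻¹ := by
    calc A⁻¹ - (A + D)⁻¹ = (A + D)⁻¹ * (A + D) * A⁻¹ - (A + D)⁻¹ * (A * A⁻¹) := by
          rw [nonsing_inv_mul _ hBu, mul_nonsing_inv _ hAu, Matrix.mul_one, Matrix.one_mul]
      _ = _ := by noncomm_ring
  rw [← sub_nonneg]
  have h3 : A⁻¹ * D * A⁻¹ - (A⁻¹ - (A + D)⁻¹) = A⁻¹ * D * (A + D)⁻¹ * (A⁻¹ * D)ᵀ := by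
    rw [transpose_mul, hAT, hDT]
    calc _ = A⁻¹ * D * (A⁻¹ - (A + D)⁻¹) := by rw [Matrix.mul_sub, ← h1]
      _ = _ := by rw [h2]; simp only [Matrix.mul_assoc]
  rw [h3]
  exact conj_nonneg (inv_nonneg_of_posDef hB) _

/-- If `Mᵀ M ≤ c` and `M` has `κ` columns, then `det (1 + Mᵀ diag(μ) M)` is at most the product of
`1 + c μ i` over the `κ` largest values `μ i`. The threshold `t` separates those values from the
rest; for `t = 0` the set `S` may have any size. -/
theorem det_one_add_conj_diagonal_le {M : Matrix m n ℝ} {c t : ℝ} (hc : 0 ≤ c)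
    (hM : Mᵀ * M ≤ c • 1) {μ : m → ℝ} (hμ : 0 ≤ μ) (S : Finset m) (ht : 0 ≤ t)
    (hS : ∀ i ∈ S, t ≤ μ i) (hS' : ∀ i ∉ S, μ i ≤ t)
    (hcard : t = 0 ∨ S.card = Fintype.card n) :
    (1 + Mᵀ * diagonal μ * M).det ≤ ∏ i ∈ S, (1 + c * μ i) := by
  -- Since μ ≤ t + ν, the part `t` contributes at most the scalar tc, and only the excess ν,
  -- supported on `S`, remains.
  set ν : m → ℝ := fun i => if i ∈ S then μ i - t else 0 with hν
  have hν0 : ∀ i, 0 ≤ ν i := fun i => by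
    by_cases hi : i ∈ S <;> simp [hν, hi, hS]
  set a : ℝ := 1 + t * c with ha
  have ha0 : 0 < a := by positivity
  set R : Matrix m m ℝ := diagonal fun i => √(ν i) with hR
  have hRR : R * R = diagonal ν := by
    simp [hR, diagonal_mul_diagonal, Real.mul_self_sqrt (hν0 _)]
  have hRT : Rᵀ = R := by simp [hR]
  have hle : diagonal μ ≤ t • 1 + diagonal ν := by
    rw [smul_one_eq_diagonal, diagonal_add]
    refine diagonal_le_diagonal fun i => ?_
    by_cases hi : i ∈ S
    · simp [hν, hi]
    · simpa [hν, hi] using hS' i hi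
  have h1 : Mᵀ * diagonal μ * M ≤ (t * c) • 1 + Mᵀ * diagonal ν * M := by
    refine (conj_le_conj' hle M).trans ?_
    have e : Mᵀ * (t • 1 + diagonal ν) * M = t • (Mᵀ * M) + Mᵀ * diagonal ν * M := by
      simp [Matrix.mul_add, Matrix.add_mul]
    rw [e, mul_smul]
    exact add_le_add_left (smul_le_smul_left_of_nonneg hM ht) _
  have hμ0 : 0 ≤ diagonal μ := by simpa using diagonal_le_diagonal hμ
  have h2 : (1 : Matrix n n ℝ) + ((t * c) • 1 + Mᵀ * diagonal ν * M)
      = a • (1 + (Mᵀ * R) * (a⁻¹ • (R * M))) := by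
    have e : (Mᵀ * R) * (a⁻¹ • (R * M)) = a⁻¹ • (Mᵀ * diagonal ν * M) := by
      rw [← hRR]; simp [Matrix.mul_assoc]
    rw [e, smul_add, smul_smul, mul_inv_cancel₀ ha0.ne', one_smul, ha, add_smul, one_smul,
      add_assoc]
  -- On the other side of Sylvester's identity, MMᵀ ≤ c makes the bound diagonal.
  have h3 : (a⁻¹ • (R * M)) * (Mᵀ * R) ≤ diagonal fun i => a⁻¹ * c * ν i := by
    have hMM := mul_transpose_le_of_transpose_mul_le hc hM
    calc (a⁻¹ • (R * M)) * (Mᵀ * R) = a⁻¹ • (R * (M * Mᵀ) * Rᵀ) := by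
          rw [hRT]; simp [Matrix.mul_assoc]
      _ ≤ a⁻¹ • (R * (c • 1) * Rᵀ) :=
          smul_le_smul_left_of_nonneg (conj_le_conj hMM R) (inv_pos.mpr ha0).le
      _ = a⁻¹ • c • diagonal ν := by rw [hRT, ← hRR]; simp
      _ = _ := by rw [smul_smul, ← diagonal_smul]; rfl
  have h4 : 0 ≤ (a⁻¹ • (R * M)) * (Mᵀ * R) := by
    have := smul_le_smul_left_of_nonneg (mul_transpose_nonneg (R * M)) (inv_pos.mpr ha0).le
    simpa [hRT] using this
  have h5 : ∏ i, (1 + a⁻¹ * c * ν i) = ∏ i ∈ S, (a⁻¹ * (1 + c * μ i)) := by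
    rw [← Finset.prod_subset (Finset.subset_univ S)]
    · refine Finset.prod_congr rfl fun i hi => ?_
      simp only [hν, hi, if_true]
      field_simp
      rw [ha]; ring
    · intro i _ hi
      simp [hν, hi]
  calc (1 + Mᵀ * diagonal μ * M).det
      ≤ (1 + ((t * c) • 1 + Mᵀ * diagonal ν * M)).det := det_one_add_le (conj_nonneg' hμ0 M) h1
    _ = a ^ Fintype.card n * (1 + (a⁻¹ • (R * M)) * (Mᵀ * R)).det := by
        rw [h2, det_smul, det_one_add_mul_comm]
    _ ≤ a ^ Fintype.card n * (1 + diagonal fun i => a⁻¹ * c * ν i).det := by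
        gcongr
        exact det_one_add_le h4 h3
    _ = a ^ Fintype.card n * ∏ i ∈ S, (a⁻¹ * (1 + c * μ i)) := by
        rw [← h5, ← diagonal_one, diagonal_add, det_diagonal]
    _ = ∏ i ∈ S, (1 + c * μ i) := by
        rw [Finset.prod_mul_distrib, Finset.prod_const]
        -- The power of `a` from the scalar part cancels the a⁻¹ in each factor over `S`, either
        -- because the exponents agree or because t = 0 gives a = 1.
        rcases hcard with h0 | h0
        · simp [ha, h0]
        · rw [h0, ← mul_assoc, ← mul_pow, mul_inv_cancel₀ ha0.ne', one_pow, one_mul]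

/-- Effect on `det (1 + Xᵀ B⁻¹ X)` of perturbing `B` by a positive semidefinite matrix. -/
theorem det_one_add_conj_inv_le {p : Type*} [Fintype p] [DecidableEq p]
    {B : Matrix m m ℝ} {X : Matrix m n ℝ} {V : Matrix p p ℝ} {W : Matrix m p ℝ} {s z t : ℝ}
    (hs : 0 < s) (hB : s • 1 ≤ B) (hz : 0 ≤ z) (hX : Xᵀ * X ≤ z • 1) (hV : V * Vᵀ = 1)
    (hW : W * Wᵀ = 1) {μ : p → ℝ} (hμ : 0 ≤ μ) (S : Finset p) (ht : 0 ≤ t)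
    (hS : ∀ i ∈ S, t ≤ μ i) (hS' : ∀ i ∉ S, μ i ≤ t) (hcard : t = 0 ∨ S.card = Fintype.card n) :
    (1 + Xᵀ * B⁻¹ * X).det ≤
      (1 + Xᵀ * (B + W * (V * diagonal μ * Vᵀ) * Wᵀ)⁻¹ * X).det
        * ∏ i ∈ S, (1 + z / s ^ 2 * μ i) := by
  have hBpd := posDef_of_le (PosDef.one.smul hs) hB
  have hμ0 : 0 ≤ diagonal μ := by simpa using diagonal_le_diagonal hμ
  set D := W * (V * diagonal μ * Vᵀ) * Wᵀ with hD
  have hD0 : 0 ≤ D := conj_nonneg (conj_nonneg hμ0 V) W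
  have hBD : (B + D).PosDef := hBpd.add_posSemidef (nonneg_iff_posSemidef.mp hD0)
  have hBT : B⁻¹ᵀ = B⁻¹ := by simpa [IsHermitian] using hBpd.inv.isHermitian
  set Q := Xᵀ * (B + D)⁻¹ * X with hQ
  have hQ0 : 0 ≤ Q := conj_nonneg' (inv_nonneg_of_posDef hBD) X
  set G := Xᵀ * (B⁻¹ - (B + D)⁻¹) * X with hG
  have hG0 : 0 ≤ G := conj_nonneg'
    (sub_nonneg.mpr (inv_le_inv_of_le hBpd (le_add_of_nonneg_right hD0))) X
  set M := Vᵀ * Wᵀ * B⁻¹ * X with hM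
  have hMT : Mᵀ = Xᵀ * B⁻¹ * W * V := by simp [hM, hBT, Matrix.mul_assoc]
  have hGM : G ≤ Mᵀ * diagonal μ * M := by
    refine (conj_le_conj' (inv_sub_inv_add_le hBpd hD0) X).trans (le_of_eq ?_)
    rw [hMT, hM, hD]
    simp only [Matrix.mul_assoc]
  have hMM : Mᵀ * M ≤ (z / s ^ 2) • 1 := by
    calc Mᵀ * M = Xᵀ * B⁻¹ * (W * (V * Vᵀ) * Wᵀ) * B⁻¹ * X := by
          rw [hMT, hM]; simp only [Matrix.mul_assoc]
      _ = Xᵀ * (B⁻¹ * B⁻¹) * X := by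
          rw [hV, Matrix.mul_one, hW, Matrix.mul_one]; simp only [Matrix.mul_assoc]
      _ ≤ Xᵀ * ((s ^ 2)⁻¹ • 1) * X := conj_le_conj' (inv_mul_inv_le hs hB) X
      _ = (s ^ 2)⁻¹ • (Xᵀ * X) := by simp
      _ ≤ (s ^ 2)⁻¹ • z • 1 := smul_le_smul_left_of_nonneg hX (by positivity)
      _ = (z / s ^ 2) • 1 := by rw [smul_smul, div_eq_inv_mul]
  have h1 : (1 + Xᵀ * B⁻¹ * X).det ≤ (1 + Q).det * (1 + G).det := by
    have := det_add_mul_det_le PosDef.one (le_add_of_nonneg_right hQ0) hG0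
    rw [det_one, mul_one] at this
    refine le_of_eq_of_le ?_ this
    rw [add_assoc, hQ, hG, ← Matrix.add_mul, ← Matrix.mul_add, add_sub_cancel]
  refine h1.trans (mul_le_mul_of_nonneg_left ?_ (posDef_one_add hQ0).det_pos.le)
  exact (det_one_add_le hG0 hGM).trans
    (det_one_add_conj_diagonal_le (by positivity) hMM hμ S ht hS hS' hcard)

/-- Determinant form of the error bound: with `A ≥ X Xᵀ` and `B ≥ C` the exact and truncated
covariances, both gains compare with the gain for the pair `X Xᵀ`, `B`. -/
theorem abs_log_det_sub_log_det_le {A B C : Matrix m m ℝ} {X : Matrix m n ℝ} {T R : ℝ} (hC : C.PosDef)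
    (hCB : C ≤ B) (hXA : X * Xᵀ ≤ A)
    (hT : (B + A).det ≤ (B + X * Xᵀ).det * T)
    (hR : (1 + Xᵀ * C⁻¹ * X).det ≤ (1 + Xᵀ * B⁻¹ * X).det * R) (hT1 : 1 ≤ T) (hR1 : 1 ≤ R) :
    |Real.log (1 + B⁻¹ * A).det - Real.log (1 + C⁻¹ * (X * Xᵀ)).det|
      ≤ Real.log T + Real.log R := by
  have hB := posDef_of_le hC hCB
  have hBX : (B + X * Xᵀ).PosDef :=
    hB.add_posSemidef (nonneg_iff_posSemidef.mp (mul_transpose_nonneg X))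
  have hle : B + X * Xᵀ ≤ B + A := add_le_add_right hXA B
  -- Common lower bound: the two determinants lie in [p, pT] and [p, pR].
  set p := (1 + Xᵀ * B⁻¹ * X).det with hp
  have hp0 : 0 < p := (posDef_one_add (conj_nonneg' (inv_nonneg_of_posDef hB) X)).det_pos
  have eC : (1 + C⁻¹ * (X * Xᵀ)).det = (1 + Xᵀ * C⁻¹ * X).det := by
    rw [← Matrix.mul_assoc, det_one_add_mul_comm, Matrix.mul_assoc]
  have eB : (B + X * Xᵀ).det = B.det * p := det_add_mul _ _ (isUnit_det_of_posDef hB)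
  have eA : (B + A).det = B.det * (1 + B⁻¹ * A).det := by
    rw [← det_mul, Matrix.mul_add, Matrix.mul_one,
      mul_nonsing_inv_cancel_left _ _ (isUnit_det_of_posDef hB)]
  have hpq : p ≤ (1 + Xᵀ * C⁻¹ * X).det :=
    det_one_add_le (conj_nonneg' (inv_nonneg_of_posDef hB) X)
      (conj_le_conj' (inv_le_inv_of_le hC hCB) X)
  have hpa : p ≤ (1 + B⁻¹ * A).det := by
    have := det_le_det hBX hle
    rw [eA, eB] at this
    exact le_of_mul_le_mul_left this hB.det_pos
  have haT : (1 + B⁻¹ * A).det ≤ p * T := by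
    rw [eA, eB, mul_assoc] at hT
    exact le_of_mul_le_mul_left hT hB.det_pos
  rw [eC]
  set a := (1 + B⁻¹ * A).det
  set q := (1 + Xᵀ * C⁻¹ * X).det
  have l1 := Real.log_le_log hp0 hpq
  have l2 := Real.log_le_log hp0 hpa
  have l3 := Real.log_le_log (hp0.trans_le hpa) haT
  have l4 := Real.log_le_log (hp0.trans_le hpq) hR
  rw [Real.log_mul hp0.ne' (by positivity)] at l3 l4
  have l5 := Real.log_nonneg hT1
  have l6 := Real.log_nonneg hR1
  rw [abs_le]
  constructor <;> linarith

end General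

/-! ### Designs, truncated eigendecompositions and the eigenvalue window. -/

section Spectral

variable {d r : ℕ}

/-- Entries equal their squares, so each row has norm 1; two rows sharing a 1 would force a column
sum of at least 2. -/
theorem IsDesign.mul_transpose {W : Matrix (Fin r) (Fin d) ℝ} (hW : IsDesign W) :
    W * Wᵀ = 1 := by
  ext i i'
  rw [mul_apply]
  simp only [transpose_apply]
  rcases eq_or_ne i i' with rfl | hne
  · rw [one_apply_eq, ← hW.row_sum i]
    refine Finset.sum_congr rfl fun j _ => ?_
    rcases hW.entry i j with h | h <;> simp [h]
  · rw [one_apply_ne hne]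
    refine Finset.sum_eq_zero fun j _ => ?_
    rcases hW.entry i j with h | h
    · simp [h]
    rcases hW.entry i' j with h' | h'
    · simp [h']
    have hnn : ∀ a ∈ Finset.univ, 0 ≤ W a j := fun a _ => by
      rcases hW.entry a j with ha | ha <;> simp [ha]
    have h2 := Finset.add_le_sum hnn (Finset.mem_univ i) (Finset.mem_univ i') hne
    rcases hW.col_sum j with hj | hj <;> linarith

theorem IsEigendecomposition.nonneg {H U : Matrix (Fin d) (Fin d) ℝ} {ζ : Fin d → ℝ}
    (h : IsEigendecomposition H U ζ) (hH : 0 ≤ H) : 0 ≤ ζ := by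
  have e : Uᵀ * H * U = diagonal ζ := by
    calc Uᵀ * H * U = (Uᵀ * U) * diagonal ζ * (Uᵀ * U) := by
          rw [h.eq]; simp only [Matrix.mul_assoc]
      _ = diagonal ζ := by rw [h.orthogonal, Matrix.one_mul, Matrix.mul_one]
  have := conj_nonneg' hH U
  rw [e, nonneg_iff_posSemidef, posSemidef_diagonal_iff] at this
  exact this

theorem truncation_eq (U : Matrix (Fin d) (Fin d) ℝ) (ζ : Fin d → ℝ) {k : ℕ} (hk : k ≤ d) :
    truncation U ζ hk = U * diagonal (fun i => if i.val < k then ζ i else 0) * Uᵀ := by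
  ext a b
  rw [truncation, mul_apply, mul_apply]
  simp only [mul_diagonal, transpose_apply, submatrix_apply, id_eq]
  refine Fintype.sum_of_injective (Fin.castLE hk) (Fin.castLE_injective hk) _ _ ?_ ?_
  · intro i hi
    have : ¬ i.val < k := fun hlt => hi ⟨⟨i, hlt⟩, rfl⟩
    simp [this]
  · intro i
    simp

/-- A truncated eigendecomposition differs from the matrix by the discarded eigenvalues. -/
theorem IsEigendecomposition.eq_truncation_add {H U : Matrix (Fin d) (Fin d) ℝ} {ζ : Fin d → ℝ}
    (h : IsEigendecomposition H U ζ) {k : ℕ} (hk : k ≤ d) :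
    H = truncation U ζ hk + U * diagonal (fun i => if i.val < k then 0 else ζ i) * Uᵀ := by
  rw [truncation_eq, ← Matrix.add_mul, ← Matrix.mul_add, diagonal_add, h.eq]
  congr 3
  ext i
  split_ifs <;> simp

/-- `W Ĥ Wᵀ = X Xᵀ` with `X` having `k` columns. -/
theorem exists_truncation_eq_mul_transpose (U : Matrix (Fin d) (Fin d) ℝ) {ζ : Fin d → ℝ}
    (hζ : 0 ≤ ζ) {k : ℕ} (hk : k ≤ d) (W : Matrix (Fin r) (Fin d) ℝ) :
    ∃ X : Matrix (Fin r) (Fin k) ℝ, W * truncation U ζ hk * Wᵀ = X * Xᵀ := by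
  set R : Matrix (Fin k) (Fin k) ℝ := diagonal fun i => √(ζ (Fin.castLE hk i)) with hR
  have hRR : R * R = diagonal fun i => ζ (Fin.castLE hk i) := by
    simp [hR, diagonal_mul_diagonal, Real.mul_self_sqrt (hζ _)]
  have hRT : Rᵀ = R := by simp [hR]
  refine ⟨W * U.submatrix id (Fin.castLE hk) * R, ?_⟩
  rw [truncation, ← hRR, transpose_mul, transpose_mul, hRT]
  simp only [Matrix.mul_assoc]

theorem truncation_le [NeZero d] {U : Matrix (Fin d) (Fin d) ℝ} {ζ : Fin d → ℝ}
    (hU : U * Uᵀ = 1) (hζ : 0 ≤ ζ) (hanti : Antitone ζ) {k : ℕ} (hk : k ≤ d) :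
    truncation U ζ hk ≤ ζ 0 • 1 := by
  have : diagonal (fun i : Fin d => if i.val < k then ζ i else 0) ≤ ζ 0 • 1 := by
    rw [smul_one_eq_diagonal]
    refine diagonal_le_diagonal fun i => ?_
    dsimp only
    split_ifs
    · exact hanti (Fin.zero_le i)
    · exact hζ 0
  rw [truncation_eq]
  simpa [hU] using conj_le_conj this U

theorem sigmaMinSq_pos [NeZero d] {σ : Fin d → ℝ} (hσ : ∀ i, 0 < σ i) : 0 < sigmaMinSq σ := by
  simpa [sigmaMinSq, Finset.lt_inf'_iff] using fun i => pow_pos (hσ i) 2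

theorem sigmaMinSq_smul_one_le [NeZero d] (σ : Fin d → ℝ) : sigmaMinSq σ • 1 ≤ noiseCov σ := by
  rw [smul_one_eq_diagonal, noiseCov]
  exact diagonal_le_diagonal fun i => Finset.inf'_le _ (Finset.mem_univ i)

/-- A threshold separating the eigenvalues at positions `l, …, l + k - 1` from the later ones. -/
theorem exists_threshold {lam : Fin d → ℝ} (hlam : 0 ≤ lam) (hanti : Antitone lam) (k l : ℕ) :
    ∃ t : ℝ, 0 ≤ t ∧
      (∀ i ∈ (Finset.univ.filter fun i : Fin d => l ≤ i.val ∧ i.val < l + k),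
        t ≤ if i.val < l then 0 else lam i) ∧
      (∀ i ∉ (Finset.univ.filter fun i : Fin d => l ≤ i.val ∧ i.val < l + k),
        (if i.val < l then 0 else lam i) ≤ t) ∧
      (t = 0 ∨ (Finset.univ.filter fun i : Fin d => l ≤ i.val ∧ i.val < l + k).card
        = Fintype.card (Fin k)) := by
  rcases lt_or_ge (l + k) d with h | h
  -- The first eigenvalue past the window separates, and the window has exactly `k` indices.
  · refine ⟨lam ⟨l + k, h⟩, hlam _, fun i hi => ?_, fun i hi => ?_, Or.inr ?_⟩
    · simp only [Finset.mem_filter, Finset.mem_univ, true_and] at hi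
      rw [if_neg (by omega)]
      exact hanti (by simpa [Fin.le_def] using hi.2.le)
    · simp only [Finset.mem_filter, Finset.mem_univ, true_and, not_and, not_lt] at hi
      split_ifs with hil
      · exact hlam _
      · exact hanti (by simpa [Fin.le_def] using hi (not_lt.mp hil))
    · have : (Finset.univ.filter fun i : Fin d => l ≤ i.val ∧ i.val < l + k).map Fin.valEmbedding
          = Finset.Ico l (l + k) := by
        ext a
        simp only [Finset.mem_map, Finset.mem_filter, Finset.mem_univ, true_and,
          Fin.valEmbedding_apply, Finset.mem_Ico]
        exact ⟨fun ⟨i, hi, e⟩ => e ▸ hi, fun ha => ⟨⟨a, by omega⟩, ha, rfl⟩⟩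
      rw [← Finset.card_map Fin.valEmbedding, this]
      simp
  -- The window reaches the end of the spectrum and may be shorter than `k`; the values outside it
  -- are all 0.
  · refine ⟨0, le_rfl, fun i _ => ?_, fun i hi => ?_, Or.inl rfl⟩
    · split_ifs
      · exact le_rfl
      · exact hlam i
    · simp only [Finset.mem_filter, Finset.mem_univ, true_and, not_and, not_lt] at hi
      rw [if_pos]
      by_contra hil
      exact absurd (hi (not_lt.mp hil)) (by omega)

end Spectral

/-! ### Covariances of the model and the gains as determinants on data space. -/

section Model

variable {d dm dρ r : ℕ} {Fd : Matrix (Fin d) (Fin dm) ℝ} {Γpr : Matrix (Fin dm) (Fin dm) ℝ}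
  {P : Matrix (Fin dρ) (Fin dm) ℝ}

theorem Γpr_transpose (hΓpr : Γpr.PosDef) : Γprᵀ = Γpr := by
  simpa [IsHermitian] using hΓpr.isHermitian

theorem Hdρ_nonneg (hΓpr : Γpr.PosDef) (hSpr : (qoiPriorCov Γpr P).PosDef) :
    0 ≤ Hdρ Fd Γpr P := by
  have := conj_nonneg (inv_nonneg_of_posDef hSpr) (Fd * Γpr * Pᵀ)
  simpa [Hdρ, Γpr_transpose hΓpr, Matrix.mul_assoc] using this

/-- The conditional prior covariance of the parameter given the quantity of interest. -/
theorem conditionalCov_nonneg (hΓpr : Γpr.PosDef) (hSpr : (qoiPriorCov Γpr P).PosDef) :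
    0 ≤ Γpr - Γpr * Pᵀ * (qoiPriorCov Γpr P)⁻¹ * P * Γpr := by
  let _ := hΓpr.isUnit.invertible
  let _ := hSpr.isUnit.invertible
  -- In the joint covariance of (ρ, m), the Schur complement of `Γpr` is 0, so that of Σ_pr is
  -- positive semidefinite.
  have h1 := PosDef.fromBlocks₁₁ (P * Γpr) Γpr hSpr
  have h2 := PosDef.fromBlocks₂₂ (qoiPriorCov Γpr P) (P * Γpr) hΓpr
  rw [conjTranspose_eq_transpose_of_trivial, transpose_mul, Γpr_transpose hΓpr] at h1 h2
  rw [nonneg_iff_posSemidef]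
  have e : qoiPriorCov Γpr P - P * Γpr * Γpr⁻¹ * (Γpr * Pᵀ) = 0 := by
    rw [Matrix.mul_assoc P, mul_nonsing_inv _ (isUnit_det_of_posDef hΓpr), Matrix.mul_one,
      ← Matrix.mul_assoc, qoiPriorCov, sub_self]
  simpa [Matrix.mul_assoc] using h1.mp (h2.mpr (e ▸ PosSemidef.zero))

theorem ΔHd_eq (Fd : Matrix (Fin d) (Fin dm) ℝ) (Γpr : Matrix (Fin dm) (Fin dm) ℝ)
    (P : Matrix (Fin dρ) (Fin dm) ℝ) :
    ΔHd Fd Γpr P = Fd * (Γpr - Γpr * Pᵀ * (qoiPriorCov Γpr P)⁻¹ * P * Γpr) * Fdᵀ := by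
  simp only [ΔHd, Hd, Hdρ, Matrix.mul_sub, Matrix.sub_mul, Matrix.mul_assoc]

theorem ΔHd_nonneg (hΓpr : Γpr.PosDef) (hSpr : (qoiPriorCov Γpr P).PosDef) :
    0 ≤ ΔHd Fd Γpr P := by
  rw [ΔHd_eq]
  exact conj_nonneg (conditionalCov_nonneg hΓpr hSpr) Fd

theorem etaCov_eq (σ : Fin d → ℝ) (W : Matrix (Fin r) (Fin d) ℝ) :
    etaCov Fd Γpr P σ W = W * (noiseCov σ + ΔHd Fd Γpr P) * Wᵀ := by
  rw [etaCov, ΔHd_eq, transpose_mul, Matrix.mul_add, Matrix.add_mul]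
  simp only [Matrix.mul_assoc]

/-- Sylvester's identity joins the two square roots into Σ_pr, and P_† Σ_pr P_†ᵀ = Γ_pr Pᵀ Σ_pr⁻¹ P
Γ_pr. -/
theorem eig_eq (hΓpr : Γpr.PosDef) (hSpr : (qoiPriorCov Γpr P).PosDef) (σ : Fin d → ℝ)
    (W : Matrix (Fin r) (Fin d) ℝ) :
    eig Fd Γpr P σ W = 1 / 2 *
      Real.log (1 + (etaCov Fd Γpr P σ W)⁻¹ * (W * Hdρ Fd Γpr P * Wᵀ)).det := by
  set S := qoiPriorCov Γpr P with hS
  have hsq : CFC.sqrt S * CFC.sqrt S = S :=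
    CFC.sqrt_mul_sqrt_self S (nonneg_iff_posSemidef.mpr hSpr.posSemidef)
  have hST : S⁻¹ᵀ = S⁻¹ := by simpa [IsHermitian] using hSpr.inv.isHermitian
  have hA : W * Fd * Pdagger Γpr P * S * (W * Fd * Pdagger Γpr P)ᵀ = W * Hdρ Fd Γpr P * Wᵀ := by
    have hinv : S⁻¹ * S = 1 := nonsing_inv_mul _ (isUnit_det_of_posDef hSpr)
    calc _ = W * (Fd * Γpr * Pᵀ * (S⁻¹ * S) * S⁻¹ * P * Γpr * Fdᵀ) * Wᵀ := by
          simp only [Pdagger, transpose_mul, ← hS, hST, Γpr_transpose hΓpr, transpose_transpose,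
            Matrix.mul_assoc]
      _ = _ := by rw [hinv, Matrix.mul_one, Hdρ]
  rw [eig, goalHessian, ← hA]
  congr 2
  set G := W * Fd * Pdagger Γpr P
  calc _ = (1 + (CFC.sqrt S * Gᵀ) * ((etaCov Fd Γpr P σ W)⁻¹ * G * CFC.sqrt S)).det := by
        simp only [Matrix.mul_assoc]; rfl
    _ = (1 + (etaCov Fd Γpr P σ W)⁻¹ * (G * (CFC.sqrt S * CFC.sqrt S) * Gᵀ)).det := by
        rw [det_one_add_mul_comm]; simp only [Matrix.mul_assoc]
    _ = _ := by rw [hsq]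

theorem eigApprox_eq {H : Matrix (Fin d) (Fin d) ℝ} {C L : Matrix (Fin r) (Fin r) ℝ}
    {W : Matrix (Fin r) (Fin d) ℝ} (hL : C⁻¹ = L * Lᵀ) :
    eigApprox H L W = 1 / 2 * Real.log (1 + C⁻¹ * (W * H * Wᵀ)).det := by
  have e : Lᵀ * W * H * Wᵀ * L = Lᵀ * (W * H * Wᵀ * L) := by simp only [Matrix.mul_assoc]
  have e' : W * H * Wᵀ * L * Lᵀ = W * H * Wᵀ * (L * Lᵀ) := by simp only [Matrix.mul_assoc]
  rw [eigApprox, e, det_one_add_mul_comm, e', ← hL, det_one_add_mul_comm]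

end Model

end GOOED

/-! ### The error bound. -/

open Matrix in
open scoped MatrixOrder in
/-- Indices are 0-based: `ζ i` for `i : Fin d` is the `(i+1)`-st largest eigenvalue, so the first
sum is over the positions `k+1, …, d` and the second over `l+1, …, min(l+k, d)`. `Lhat` is any
factor of `Γ̂_η(W)⁻¹`, in particular the Cholesky factor. -/
theorem theorem3p2 {d dm dρ r k l : ℕ} [NeZero d]
    (Fd : Matrix (Fin d) (Fin dm) ℝ) (Γpr : Matrix (Fin dm) (Fin dm) ℝ)
    (P : Matrix (Fin dρ) (Fin dm) ℝ) (σ : Fin d → ℝ)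
    (hΓpr : Γpr.PosDef) (hSpr : (GOOED.qoiPriorCov Γpr P).PosDef) (hσ : ∀ i, 0 < σ i)
    (U V : Matrix (Fin d) (Fin d) ℝ) (ζ lam : Fin d → ℝ)
    (hU : GOOED.IsEigendecomposition (GOOED.Hdρ Fd Γpr P) U ζ)
    (hV : GOOED.IsEigendecomposition (GOOED.ΔHd Fd Γpr P) V lam)
    (hk : k ≤ d) (hl : l ≤ d)
    (W : Matrix (Fin r) (Fin d) ℝ) (hW : GOOED.IsDesign W)
    (Lhat : Matrix (Fin r) (Fin r) ℝ)
    (hLhat : (GOOED.etaCovApprox σ (GOOED.truncation V lam hl) W)⁻¹ = Lhat * Lhat.transpose) :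
    |GOOED.eig Fd Γpr P σ W - GOOED.eigApprox (GOOED.truncation U ζ hk) Lhat W| ≤
      1 / 2 * ∑ i : Fin d with k ≤ i.val, Real.log (1 + ζ i / GOOED.sigmaMinSq σ)
      + 1 / 2 * ∑ i : Fin d with l ≤ i.val ∧ i.val < l + k,
          Real.log (1 + lam i * ζ 0 / GOOED.sigmaMinSq σ ^ 2) := by
  have hζ := hU.nonneg (GOOED.Hdρ_nonneg hΓpr hSpr)
  have hlam := hV.nonneg (GOOED.ΔHd_nonneg hΓpr hSpr)
  have hUU : U * Uᵀ = 1 := mul_eq_one_comm.mp hU.orthogonal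
  have hVV : V * Vᵀ = 1 := mul_eq_one_comm.mp hV.orthogonal
  have hWW := hW.mul_transpose
  have hs := GOOED.sigmaMinSq_pos hσ
  set s := GOOED.sigmaMinSq σ
  set μ : Fin d → ℝ := fun i => if i.val < l then 0 else lam i with hμ
  set ξ : Fin d → ℝ := fun i => if i.val < k then 0 else ζ i with hξ
  have hμ0 : 0 ≤ μ := fun i => by by_cases h : i.val < l <;> simp [hμ, h]; exact hlam i
  have hξ0 : 0 ≤ ξ := fun i => by by_cases h : i.val < k <;> simp [hξ, h]; exact hζ i
  obtain ⟨X, hX⟩ := GOOED.exists_truncation_eq_mul_transpose U hζ hk W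
  have hXX : Xᵀ * X ≤ ζ 0 • 1 := by
    have := GOOED.conj_le_conj (GOOED.truncation_le hUU hζ hU.antitone hk) W
    rw [hX] at this
    simpa using GOOED.mul_transpose_le_of_transpose_mul_le (M := Xᵀ) (hζ 0)
      (by simpa [hWW] using this)
  set C := GOOED.etaCovApprox σ (GOOED.truncation V lam hl) W with hC
  have hsC : s • 1 ≤ C := by
    have h0 : 0 ≤ GOOED.truncation V lam hl := by
      rw [GOOED.truncation_eq]
      refine GOOED.conj_nonneg ?_ V
      rw [nonneg_iff_posSemidef, posSemidef_diagonal_iff]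
      intro i
      split_ifs
      · exact hlam i
      · exact le_rfl
    have := GOOED.conj_le_conj
      ((GOOED.sigmaMinSq_smul_one_le σ).trans (le_add_of_nonneg_right h0)) W
    rw [Matrix.mul_smul, Matrix.mul_one, Matrix.smul_mul, hWW] at this
    exact this
  have hCpd := GOOED.posDef_of_le (PosDef.one.smul hs) hsC
  set B := GOOED.etaCov Fd Γpr P σ W with hB
  have hBC : B = C + W * (V * diagonal μ * Vᵀ) * Wᵀ := by
    rw [hB, GOOED.etaCov_eq, hV.eq_truncation_add hl, ← add_assoc, Matrix.mul_add, Matrix.add_mul]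
    rfl
  have hμd : 0 ≤ diagonal μ := by simpa using GOOED.diagonal_le_diagonal hμ0
  have hξd : 0 ≤ diagonal ξ := by simpa using GOOED.diagonal_le_diagonal hξ0
  have hCB : C ≤ B := by
    rw [hBC]
    exact le_add_of_nonneg_right (GOOED.conj_nonneg (GOOED.conj_nonneg hμd V) W)
  set A := W * GOOED.Hdρ Fd Γpr P * Wᵀ with hA
  set G := W * (U * diagonal ξ * Uᵀ) * Wᵀ with hG
  have hG0 : 0 ≤ G := GOOED.conj_nonneg (GOOED.conj_nonneg hξd U) W
  have hAX : A = X * Xᵀ + G := by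
    rw [hA, hU.eq_truncation_add hk, Matrix.mul_add, Matrix.add_mul, hX]
  set S : Finset (Fin d) := {i | l ≤ i.val ∧ i.val < l + k} with hSdef
  set K : Finset (Fin d) := {i | k ≤ i.val} with hKdef
  obtain ⟨t, ht, hSt, hSt', hcard⟩ := GOOED.exists_threshold hlam hV.antitone k l
  have hR := GOOED.det_one_add_conj_inv_le hs hsC (hζ 0) hXX hVV hWW hμ0 S ht hSt hSt' hcard
  rw [← hBC] at hR
  have hXXnn := GOOED.mul_transpose_nonneg X
  have hT : (B + A).det ≤ (B + X * Xᵀ).det * ∏ i ∈ K, (1 + 1 * (s⁻¹ * ξ i)) := by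
    have hsB : s • 1 ≤ B + X * Xᵀ := (hsC.trans hCB).trans (le_add_of_nonneg_right hXXnn)
    -- The base B + XXᵀ is lowered to s; the factor sʳ then appears on both sides and cancels.
    have h1 := GOOED.det_add_mul_det_le (PosDef.one.smul hs) hsB hG0
    have hMM : (Uᵀ * Wᵀ)ᵀ * (Uᵀ * Wᵀ) = 1 := by
      calc (Uᵀ * Wᵀ)ᵀ * (Uᵀ * Wᵀ) = W * (U * Uᵀ) * Wᵀ := by
            simp [Matrix.mul_assoc]
        _ = 1 := by rw [hUU, Matrix.mul_one, hWW]
    have hin : ∀ i ∈ K, 0 ≤ s⁻¹ * ξ i := fun i _ => mul_nonneg (inv_pos.mpr hs).le (hξ0 i)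
    have hout : ∀ i ∉ K, s⁻¹ * ξ i ≤ 0 := fun i hi => by
      have : i.val < k := by simpa [hKdef] using hi
      simp [hξ, this]
    -- With threshold 0 no column count is needed: every discarded ζᵢ is kept.
    have h2 := GOOED.det_one_add_conj_diagonal_le (c := 1) (t := 0) zero_le_one
      (by rw [hMM, one_smul]) (fun i => mul_nonneg (inv_pos.mpr hs).le (hξ0 i)) K le_rfl hin hout
      (Or.inl rfl)
    have e : s • 1 + G
        = s • (1 + (Uᵀ * Wᵀ)ᵀ * diagonal (fun i => s⁻¹ * ξ i) * (Uᵀ * Wᵀ)) := by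
      have e1 : diagonal (fun i => s⁻¹ * ξ i) = s⁻¹ • diagonal ξ := by
        rw [← diagonal_smul]; rfl
      rw [e1, smul_add, hG]
      simp [Matrix.mul_assoc, smul_smul, hs.ne']
    rw [e, det_smul, det_smul, det_one, mul_one, add_assoc, ← hAX, mul_left_comm,
      mul_comm _ (s ^ _)] at h1
    have hsr : 0 < s ^ Fintype.card (Fin r) := by positivity
    have h3 := le_of_mul_le_mul_left h1 hsr
    exact h3.trans (mul_le_mul_of_nonneg_left h2
      (GOOED.posDef_of_le (PosDef.one.smul hs) hsB).det_pos.le)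
  have hTi : ∀ i ∈ K, 1 ≤ 1 + 1 * (s⁻¹ * ξ i) := fun i _ => by
    have := mul_nonneg (inv_pos.mpr hs).le (hξ0 i)
    linarith
  have hRi : ∀ i ∈ S, 1 ≤ 1 + ζ 0 / s ^ 2 * μ i := fun i _ => by
    have := mul_nonneg (div_nonneg (hζ 0) (sq_nonneg s)) (hμ0 i)
    linarith
  have hT1 : 1 ≤ ∏ i ∈ K, (1 + 1 * (s⁻¹ * ξ i)) := by
    simpa using Finset.prod_le_prod (fun _ _ => zero_le_one) hTi
  have hR1 : 1 ≤ ∏ i ∈ S, (1 + ζ 0 / s ^ 2 * μ i) := by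
    simpa using Finset.prod_le_prod (fun _ _ => zero_le_one) hRi
  have key := GOOED.abs_log_det_sub_log_det_le hCpd hCB
    (hAX ▸ le_add_of_nonneg_right hG0) hT hR hT1 hR1
  rw [Real.log_prod fun i hi => (zero_lt_one.trans_le (hTi i hi)).ne',
    Real.log_prod fun i hi => (zero_lt_one.trans_le (hRi i hi)).ne'] at key
  have eT : ∑ i ∈ K, Real.log (1 + 1 * (s⁻¹ * ξ i)) = ∑ i ∈ K, Real.log (1 + ζ i / s) := by
    refine Finset.sum_congr rfl fun i hi => ?_
    have : ¬ i.val < k := by simpa [hKdef] using hi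
    simp only [hξ, this, if_false, one_mul, div_eq_inv_mul]
  have eR : ∑ i ∈ S, Real.log (1 + ζ 0 / s ^ 2 * μ i)
      = ∑ i ∈ S, Real.log (1 + lam i * ζ 0 / s ^ 2) := by
    refine Finset.sum_congr rfl fun i hi => ?_
    have : ¬ i.val < l := by
      simp only [hSdef, Finset.mem_filter] at hi
      omega
    simp only [hμ, this, if_false]
    congr 2
    ring
  rw [eT, eR] at key
  rw [GOOED.eig_eq hΓpr hSpr, GOOED.eigApprox_eq hLhat, hX, ← mul_sub, abs_mul,
    abs_of_pos (by norm_num : (0 : ℝ) < 1 / 2), ← mul_add]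
  exact mul_le_mul_of_nonneg_left key (by norm_num)
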